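/- \textbf{Conventions.} For an associative unital ring $R$ let $R_{\mathfrak{lie}}^{(1)}=R$, $R_{\mathfrak{lie}}^{(t+1)}=[R,R_{\mathfrak{lie}}^{(t)}]$ be the lower central series of $(R,[x,y]=xy-yx)$, let $I_t=I_t(R)$ be the two-sided ideal generated by $R_{\mathfrak{lie}}^{(t+1)}$ (so $I_1$ is generated by the commutators), and let $F_m(R)=\sum_{i_1+\cdots+i_s=m}I_{i_1}\cdots I_{i_s}$. The ring $R$ is \emph{NC-nilpotent} if $F_s(R)=0$ for some $s$, and \emph{NC-complete} if it is Hausdorff and complete in the topology given by $\{F_m(R)\}$ (its NC-topology). Put $R_c=R/I_1$. An \emph{NC-filtration} of an NC-complete ring $R$ is a decreasing filtration by two-sided ideals $R=J_0\supseteq J_1\supseteq J_2\supseteq\cdots$ with $J_1=I_1$ and all $R/J_m$ NC-nilpotent, for which $R$ is Hausdorff and complete and which defines the NC-topology of $R$. For $\zeta\in R$, $R[\zeta^{-1}]$ denotes the (Ore) ring of fractions by the powers of $\zeta$ if $R$ is NC-nilpotent, and the topological localization $\varprojlim_m (R/J_m)[\zeta^{-1}]$ if $R$ is NC-complete with NC-filtration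 $\{J_m\}$. An \emph{affine NC-scheme} is a ringed space isomorphic to the space $\operatorname{Spec}(R_c)$ with the sheaf of rings whose sections over $D(\zeta)$ (the basic open set of the class of $\zeta$ in $R_c$) are $R[\zeta^{-1}]$, compatibly with restrictions, for some NC-nilpotent $R$ (written $\operatorname{Spec} R$) or NC-complete $R$ (written $\operatorname{Spf} R$). An NC-complete ring $R$ with an NC-filtration $\{J_m\}$ and an $A$-module structure preserving the $J_m$, where $A$ is a commutative ring identified with $R_c$ through $\varepsilon:R\to A$, is an \emph{NC-deformation of the ring $A$} if for $r\in R$, $x\in J_m$ both $rx-\varepsilon(r)x$ and $xr-\varepsilon(r)x$ (with $\varepsilon(r)$ acting by the module structure) lie in $J_{m+1}$. An \emph{NC-deformation of a scheme $X$} is a sheaf $\mathcal F_X$ of $\mathcal O_X$-modules which is also a sheaf of associative unital rings with the same addition, together with a decreasing filtration $\mathcal F_X=\mathcal J_{X,0}\supseteq\mathcal J_{X,1}\supseteq\cdots$ by subsheaves of $\mathcal O_X$-modules and two-sided ideals and a surjective morphism $\varepsilon_X:\mathcal F_X\to\mathcal O_X$ of sheaves of rings and of $\mathcal O_X$-modules,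 such that: every $\mathcal F_{X,m}=\mathcal F_X/\mathcal J_{X,m}$ is a quasi-coherent $\mathcal O_X$-module and a sheaf of NC-nilpotent rings; $\mathcal F_X=\varprojlim_m\mathcal F_{X,m}$; $\mathcal J_{X,1}=\ker\varepsilon_X$ is the sheaf associated to $U\mapsto I_1(\mathcal F_X(U))$; for local sections $f$ of $\mathcal F_X$ and $x$ of $\mathcal J_{X,m}$ both $fx-\varepsilon_X(f)x$ and $xf-\varepsilon_X(f)x$ lie in $\mathcal J_{X,m+1}$; and for each affine open $U$ the filtration $\{\mathcal J_{X,m}(U)\}$ defines the NC-topology of $\mathcal F_X(U)$, i.e. each $F_s(\mathcal F_X(U))$ contains some $\mathcal J_{X,m}(U)$. It is \emph{NC-nilpotent} if $\mathcal J_{X,N}=0$ for some $N$ (the last condition then holds automatically). \textbf{Theorem.} Let $A$ be a commutative ring, $X=\operatorname{Spec}A$, and let $(X,\mathcal F_X)$ be an NC-deformation of $X$ with filtration $\{\mathcal J_{X,m}\}$. Put $R=\Gamma(X,\mathcal F_X)$, $J_m=\Gamma(X,\mathcal J_{X,m})$ and let $\varepsilon:R\to A$ be the map of global sections of $\varepsilon_X$.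 Then: (1) $R$ with $\{J_m\}$ and $\varepsilon$ is an NC-deformation of the ring $A$; in particular $R$ is NC-complete, $J_1=I_1(R)$, and $\varepsilon$ induces $R_c=R/I_1=A$. (2) $(X,\mathcal F_X)$ is an affine NC-scheme, namely $(X,\mathcal F_X)=\operatorname{Spf}(R)$ for the NC-filtration $\{J_m\}$. (3) For every $\zeta\in R$ with $a=\varepsilon(\zeta)$, the restriction $R\to\mathcal F_X(D(a))$, with the filtration $\{\mathcal J_{X,m}(D(a))\}$ on the target, is the noncommutative topological localization of $R$ at $\zeta$. For every $a\in A$ and $m$ the map $R/J_m\to\mathcal F_X(D(a))/\mathcal J_{X,m}(D(a))$ is the localization of the $A$-module $R/J_m$ at $a$. (4) If the deformation is NC-nilpotent, then $R$ is NC-nilpotent, $J_N=0$ for some $N$, $(X,\mathcal F_X)=\operatorname{Spec}(R)$ is an affine NC-nilpotent scheme, for every $\zeta\in R$ the restriction $R\to\mathcal F_X(D(\varepsilon(\zeta)))$ is the ring of fractions $R[\zeta^{-1}]$, and for every $a\in A$ the restriction $R\to\mathcal F_X(D(a))$ is the $A$-module localization $R_a$; so $R[\zeta^{-1}]=R_a$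 for $a=\varepsilon(\zeta)$. -/

import Mathlib

open CategoryTheory TopologicalSpace Opposite AlgebraicGeometry

universe u

noncomputable section

namespace NCDef

/-! ### The commutator filtration of an associative ring -/

section Rings

attribute [local instance] LieRing.ofAssociativeRing

/-- The two-sided ideal `I_t` generated by the `(t+1)`-st term of the lower central series of the
Lie ring `(R, [x, y] = x * y - y * x)`. Mathlib's series is indexed from `0`, so that `I_0 = R`
and `I_1` is the two-sided ideal generated by all commutators. -/
def ncIdeal (R : Type u) [Ring R] (t : ℕ) : TwoSidedIdeal R :=
  TwoSidedIdeal.span (LieModule.lowerCentralSeries ℤ R R t : Set R)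

/-- The NC-filtration `F_m(R) = ∑_{i_1 + ⋯ + i_s = m} I_{i_1} ⋯ I_{i_s}`. -/
def ncFil (R : Type u) [Ring R] (m : ℕ) : TwoSidedIdeal R :=
  TwoSidedIdeal.span {x | ∃ l : List (ℕ × R), (l.map Prod.fst).sum = m ∧
    (∀ p ∈ l, p.2 ∈ ncIdeal R p.1) ∧ x = (l.map Prod.snd).prod}

/-- `R` is NC-nilpotent: `F_s(R) = 0` for some (equivalently, all large) `s`. -/
def IsNCNilpotent (R : Type u) [Ring R] : Prop := ∃ s, ncFil R s = ⊥

/-- `R` is Hausdorff and complete in the topology with the basis `J` of neighbourhoods of `0`. -/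
structure IsCompleteFor {R : Type u} [Ring R] (J : ℕ → TwoSidedIdeal R) : Prop where
  hausdorff : ∀ x : R, (∀ m, x ∈ J m) → x = 0
  complete : ∀ s : ℕ → R, (∀ m, s (m + 1) - s m ∈ J m) → ∃ x : R, ∀ m, x - s m ∈ J m

/-- `R` is NC-complete: Hausdorff and complete in its NC-topology. -/
def IsNCComplete (R : Type u) [Ring R] : Prop := IsCompleteFor (ncFil R)

/-- `J` is an NC-filtration of `R`: a decreasing filtration by two-sided ideals with `J_0 = R`,
`J_1 = I_1` and NC-nilpotent quotients `R / J_m`, for which `R` is Hausdorff and complete and which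
defines the NC-topology of `R`. -/
structure IsNCFiltration {R : Type u} [Ring R] (J : ℕ → TwoSidedIdeal R) : Prop where
  antitone : Antitone J
  zero : J 0 = ⊤
  one : J 1 = ncIdeal R 1
  quotient_nilpotent : ∀ m, IsNCNilpotent (J m).ringCon.Quotient
  complete : IsCompleteFor J
  topology : ∀ s, ∃ m, J m ≤ ncFil R s

/-- The commutativization `R_c = R / I_1`. -/
def Comm (R : Type u) [Ring R] : Type u := (ncIdeal R 1).ringCon.Quotient

instance (R : Type u) [Ring R] : Ring (Comm R) :=
  inferInstanceAs (Ring (ncIdeal R 1).ringCon.Quotient)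

/-- The quotient map `R → R_c`. -/
def toComm (R : Type u) [Ring R] : R →+* Comm R := (ncIdeal R 1).ringCon.mk'

theorem toComm_surjective (R : Type u) [Ring R] : Function.Surjective (toComm R) :=
  (ncIdeal R 1).ringCon.mk'_surjective

theorem toComm_eq_zero_iff {R : Type u} [Ring R] (x : R) :
    toComm R x = 0 ↔ x ∈ ncIdeal R 1 := by
  rw [TwoSidedIdeal.mem_iff, ← map_zero (toComm R)]
  exact (ncIdeal R 1).ringCon.eq

theorem commutator_mem (R : Type u) [Ring R] (x y : R) : x * y - y * x ∈ ncIdeal R 1 := by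
  refine TwoSidedIdeal.subset_span ?_
  have h : (⁅x, y⁆ : R) ∈ LieModule.lowerCentralSeries ℤ R R 1 := by
    rw [LieModule.lowerCentralSeries_succ, LieModule.lowerCentralSeries_zero]
    exact LieSubmodule.lie_mem_lie (LieSubmodule.mem_top _) (LieSubmodule.mem_top _)
  exact h

instance (R : Type u) [Ring R] : CommRing (Comm R) :=
  { (inferInstance : Ring (Comm R)) with
    mul_comm := by
      intro a b
      obtain ⟨x, rfl⟩ := toComm_surjective R a
      obtain ⟨y, rfl⟩ := toComm_surjective R b
      rw [← sub_eq_zero, ← map_mul, ← map_mul, ← map_sub, toComm_eq_zero_iff]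
      exact commutator_mem R x y }

/-- `φ : R → T` is the (Ore) ring of fractions `R[ζ⁻¹]` of `R` by the powers of `ζ`. -/
structure IsOreLocalizationAway {R T : Type u} [Ring R] [Ring T] (ζ : R) (φ : R →+* T) :
    Prop where
  isUnit : IsUnit (φ ζ)
  surj : ∀ t : T, ∃ (n : ℕ) (r : R), φ ζ ^ n * t = φ r
  ker : ∀ r : R, φ r = 0 ↔ ∃ n : ℕ, ζ ^ n * r = 0

/-- `φ : R → T` is the topological localization of the filtered ring `(R, J)` at `ζ`, with the
filtration `K` of `T`: `T` is the inverse limit of the rings `T / K_m`, and `T / K_m` is the (Ore)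
ring of fractions `(R / J_m)[ζ⁻¹]`. -/
structure IsTopLocalizationAway {R T : Type u} [Ring R] [Ring T] (J : ℕ → TwoSidedIdeal R)
    (K : ℕ → TwoSidedIdeal T) (ζ : R) (φ : R →+* T) : Prop where
  antitone : Antitone K
  complete : IsCompleteFor K
  isUnit : IsUnit (φ ζ)
  surj : ∀ (m : ℕ) (t : T), ∃ (n : ℕ) (r : R), φ ζ ^ n * t - φ r ∈ K m
  ker : ∀ (m : ℕ) (r : R), φ r ∈ K m ↔ ∃ n : ℕ, ζ ^ n * r ∈ J m

/-- The NC-complete ring `R` with the NC-filtration `J` is an NC-deformation of the commutative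
ring `A`: `ε` identifies `R_c` with `A`, the `A`-module structure of `R` preserves the `J_m`, and
on `J_m / J_{m+1}` both actions of `R` are the pull-back along `ε` of the action of `A`. -/
structure IsNCDeformation {A R : Type u} [CommRing A] [Ring R] [Module A R] (ε : R →+* A)
    (J : ℕ → TwoSidedIdeal R) : Prop where
  ncComplete : IsNCComplete R
  filtration : IsNCFiltration J
  surjective : Function.Surjective ε
  ker : ∀ x : R, ε x = 0 ↔ x ∈ ncIdeal R 1
  smul_mem : ∀ (m : ℕ) (a : A) (x : R), x ∈ J m → a • x ∈ J m
  left_action : ∀ (m : ℕ) (r x : R), x ∈ J m → r * x - ε r • x ∈ J (m + 1)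
  right_action : ∀ (m : ℕ) (r x : R), x ∈ J m → x * r - ε r • x ∈ J (m + 1)

end Rings

/-! ### Affine NC-schemes -/

section Affine

variable {X : TopCat.{u}}

/-- Restriction of global sections to an open set. -/
def resTop (𝓞 : TopCat.Sheaf RingCat.{u} X) (U : Opens X) :
    𝓞.presheaf.obj (op ⊤) →+* 𝓞.presheaf.obj (op U) :=
  (𝓞.presheaf.map (homOfLE (le_top : U ≤ ⊤)).op).hom

/-- The open set of `X` which corresponds to `D(ζ) ⊆ Spec (R_c)`. -/
def basicOpen {R : Type u} [Ring R] (h : X ≃ₜ PrimeSpectrum (Comm R)) (ζ : R) : Opens X :=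
  Opens.comap ⟨h, h.continuous⟩ (PrimeSpectrum.basicOpen (toComm R ζ))

/-- The ringed space `(X, 𝓞)` is the affine NC-nilpotent scheme `Spec R`: the space is
`Spec (R_c)`, and the sections of `𝓞` over each basic open set `D(ζ)` are the localization
`R[ζ⁻¹]`, compatibly with restriction. -/
def IsNCSpec (𝓞 : TopCat.Sheaf RingCat.{u} X) (R : Type u) [Ring R] : Prop :=
  ∃ (h : X ≃ₜ PrimeSpectrum (Comm R)) (φ : R →+* 𝓞.presheaf.obj (op ⊤)),
    ∀ ζ : R, IsOreLocalizationAway ζ ((resTop 𝓞 (basicOpen h ζ)).comp φ)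

/-- The ringed space `(X, 𝓞)` is the affine NC-complete scheme `Spf R` of the ring `R` with the
NC-filtration `J`: the space is `Spec (R_c)`, and the sections of `𝓞` over each basic open set
`D(ζ)` are the topological localization of `R` at `ζ`, compatibly with restriction, for a
filtration `K` of `𝓞` that is preserved by restriction. -/
def IsNCSpf (𝓞 : TopCat.Sheaf RingCat.{u} X) {R : Type u} [Ring R] (J : ℕ → TwoSidedIdeal R) :
    Prop :=
  ∃ (h : X ≃ₜ PrimeSpectrum (Comm R)) (φ : R →+* 𝓞.presheaf.obj (op ⊤))
    (K : ∀ U : Opens X, ℕ → TwoSidedIdeal (𝓞.presheaf.obj (op U))),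
    (∀ (U V : Opens X) (i : U ⟶ V) (m : ℕ) (x : 𝓞.presheaf.obj (op V)),
      x ∈ K V m → (𝓞.presheaf.map i.op).hom x ∈ K U m) ∧
    ∀ ζ : R, IsTopLocalizationAway J (K (basicOpen h ζ)) ζ ((resTop 𝓞 (basicOpen h ζ)).comp φ)

/-- `(X, 𝓞)` is an affine NC-nilpotent scheme. -/
def IsAffineNCNilpotentScheme (𝓞 : TopCat.Sheaf RingCat.{u} X) : Prop :=
  ∃ (R : Type u) (_ : Ring R), IsNCNilpotent R ∧ IsNCSpec 𝓞 R

/-- `(X, 𝓞)` is an affine NC-(complete) scheme. -/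
def IsAffineNCScheme (𝓞 : TopCat.Sheaf RingCat.{u} X) : Prop :=
  ∃ (R : Type u) (_ : Ring R) (J : ℕ → TwoSidedIdeal R),
    IsNCComplete R ∧ IsNCFiltration J ∧ IsNCSpf 𝓞 J

end Affine

/-! ### Sheaves of modules with a noncommutative multiplication -/

/-- A sheaf of `𝒪_X`-modules which is at the same time a sheaf of (associative unital, not
necessarily commutative) rings with the same addition. It is not a sheaf of `𝒪_X`-algebras: the
multiplication is only biadditive. -/
structure RingedModule (X : Scheme.{u}) where
  toModules : X.Modules
  mul : ∀ U : X.Opens, Γ(toModules, U) →+ Γ(toModules, U) →+ Γ(toModules, U)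
  one : ∀ U : X.Opens, Γ(toModules, U)
  mul_assoc : ∀ U x y z, mul U (mul U x y) z = mul U x (mul U y z)
  one_mul : ∀ U x, mul U (one U) x = x
  mul_one : ∀ U x, mul U x (one U) = x
  map_mul : ∀ {U V : X.Opens} (i : U ⟶ V) (x y : Γ(toModules, V)),
    toModules.presheaf.map i.op (mul V x y) =
      mul U (toModules.presheaf.map i.op x) (toModules.presheaf.map i.op y)
  map_one : ∀ {U V : X.Opens} (i : U ⟶ V), toModules.presheaf.map i.op (one V) = one U

namespace RingedModule

variable {X : Scheme.{u}}

/-- The ring of sections over `U`. -/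
def Sec (F : RingedModule X) (U : X.Opens) : Type u := Γ(F.toModules, U)

instance (F : RingedModule X) (U : X.Opens) : AddCommGroup (F.Sec U) :=
  inferInstanceAs (AddCommGroup Γ(F.toModules, U))

instance (F : RingedModule X) (U : X.Opens) : Ring (F.Sec U) :=
  { (inferInstance : AddCommGroup (F.Sec U)) with
    mul := fun x y => F.mul U x y
    one := F.one U
    mul_assoc := F.mul_assoc U
    one_mul := F.one_mul U
    mul_one := F.mul_one U
    zero_mul := fun x => by
      change F.mul U (0 : Γ(F.toModules, U)) x = 0
      rw [map_zero]
      rfl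
    mul_zero := fun x => (F.mul U x).map_zero
    left_distrib := fun x y z => (F.mul U x).map_add y z
    right_distrib := fun x y z => DFunLike.congr_fun ((F.mul U).map_add x y) z }

instance (F : RingedModule X) (U : X.Opens) : Module Γ(X, U) (F.Sec U) :=
  inferInstanceAs (Module Γ(X, U) Γ(F.toModules, U))

instance {A : CommRingCat.{u}} (F : RingedModule (Spec A)) (U : (Spec A).Opens) :
    Module A (F.Sec U) :=
  inferInstanceAs (Module A Γ(F.toModules, U))

/-- The restriction homomorphisms. -/
def res (F : RingedModule X) {U V : X.Opens} (i : U ⟶ V) : F.Sec V →+* F.Sec U :=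
  { (F.toModules.presheaf.map i.op).hom with
    map_one' := F.map_one i
    map_mul' := F.map_mul i }

/-- The underlying sheaf of rings. -/
def ringSheaf (F : RingedModule X) : TopCat.Sheaf RingCat.{u} X.toTopCat where
  obj :=
    { obj := fun U => RingCat.of (F.Sec U.unop)
      map := fun i => RingCat.ofHom (F.res i.unop)
      map_id := fun U => by
        ext x
        exact congr($(F.toModules.presheaf.map_id U) x)
      map_comp := fun i j => by
        ext x
        exact congr($(F.toModules.presheaf.map_comp i j) x) }
  property := by
    have h := (TopCat.Presheaf.isSheaf_iff_isSheaf_comp (forget AddCommGrpCat)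
      F.toModules.presheaf).mp F.toModules.isSheaf
    exact (TopCat.Presheaf.isSheaf_iff_isSheaf_comp (forget RingCat) _).mpr h

/-- Morphisms: `𝒪_X`-linear homomorphisms of sheaves of rings. -/
structure Hom (F G : RingedModule X) where
  app : ∀ U : X.Opens, F.Sec U →+* G.Sec U
  app_smul : ∀ (U : X.Opens) (a : Γ(X, U)) (x : F.Sec U), app U (a • x) = a • app U x
  app_res : ∀ {U V : X.Opens} (i : U ⟶ V) (x : F.Sec V), app U (F.res i x) = G.res i (app V x)

/-- Surjectivity as a morphism of sheaves: each section lifts locally. -/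
def Hom.IsSurjective {F G : RingedModule X} (f : F.Hom G) : Prop :=
  ∀ (U : X.Opens) (s : G.Sec U), ∀ p ∈ U, ∃ (V : X.Opens) (i : V ⟶ U) (t : F.Sec V),
    p ∈ V ∧ f.app V t = G.res i s

end RingedModule

/-! ### NC-deformations of schemes -/

/-- An NC-deformation `(X, 𝓕)` of a scheme `X`, with its filtration `𝓙_m = ker (𝓕 → 𝓕_m)` by
subsheaves of `𝒪_X`-modules and two-sided ideals and its quotients `𝓕_m = 𝓕 / 𝓙_m`.
The stalks of such an `𝓕` are automatically local rings, and the ringed spaces `(X, 𝓕_m)` are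
automatically locally isomorphic to affine NC-nilpotent schemes, so that these conditions need not
be imposed. -/
structure NCDeformation (X : Scheme.{u}) where
  /-- the structure sheaf `𝓕` -/
  sheaf : RingedModule X
  /-- the quotient `𝓕_m = 𝓕 / 𝓙_m` -/
  quot : ℕ → RingedModule X
  /-- the quotient map `𝓕 → 𝓕_m` -/
  proj : ∀ m, sheaf.Hom (quot m)
  proj_surj : ∀ m, (proj m).IsSurjective
  /-- the induced map `𝓕_{m+1} → 𝓕_m`, so that the `𝓙_m` decrease -/
  trans : ∀ m, (quot (m + 1)).Hom (quot m)
  trans_proj : ∀ (m : ℕ) (U : X.Opens) (x : sheaf.Sec U),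
    (trans m).app U ((proj (m + 1)).app U x) = (proj m).app U x
  /-- `𝓙_0 = 𝓕` -/
  quot_zero : ∀ (U : X.Opens) (x : sheaf.Sec U), (proj 0).app U x = 0
  /-- the `𝓕_m` are quasi-coherent -/
  quasicoherent : ∀ m, (quot m).toModules.IsQuasicoherent
  /-- the `𝓕_m` are sheaves of NC-nilpotent rings -/
  quot_nilpotent : ∀ (m : ℕ) (U : X.Opens), IsNCNilpotent ((quot m).Sec U)
  /-- `𝓕` is the inverse limit of the `𝓕_m` -/
  limit : ∀ (U : X.Opens) (s : ∀ m, (quot m).Sec U),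
    (∀ m, (trans m).app U (s (m + 1)) = s m) → ∃! x : sheaf.Sec U, ∀ m, (proj m).app U x = s m
  /-- the morphism `ε : 𝓕 → 𝒪_X` -/
  aug : ∀ U : X.Opens, sheaf.Sec U →+* Γ(X, U)
  aug_smul : ∀ (U : X.Opens) (a : Γ(X, U)) (x : sheaf.Sec U), aug U (a • x) = a * aug U x
  aug_res : ∀ {U V : X.Opens} (i : U ⟶ V) (x : sheaf.Sec V),
    aug U (sheaf.res i x) = X.presheaf.map i.op (aug V x)
  /-- `ε` is surjective as a morphism of sheaves -/
  aug_surj : ∀ (U : X.Opens) (a : Γ(X, U)), ∀ p ∈ U, ∃ (V : X.Opens) (i : V ⟶ U)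
    (t : sheaf.Sec V), p ∈ V ∧ aug V t = X.presheaf.map i.op a
  /-- the kernel of `ε` is `𝓙_1` -/
  aug_ker : ∀ (U : X.Opens) (x : sheaf.Sec U), aug U x = 0 ↔ (proj 1).app U x = 0
  /-- `𝓙_1` is the sheaf associated to `U ↦ I([𝓕(U), 𝓕(U)])` -/
  commutator : ∀ (U : X.Opens) (x : sheaf.Sec U), (proj 1).app U x = 0 ↔
    ∀ p ∈ U, ∃ (V : X.Opens) (i : V ⟶ U), p ∈ V ∧ sheaf.res i x ∈ ncIdeal (sheaf.Sec V) 1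
  /-- on `𝓙_m / 𝓙_{m+1}` the left action of `𝓕` is pulled back along `ε` -/
  left_action : ∀ (m : ℕ) (U : X.Opens) (f x : sheaf.Sec U), (proj m).app U x = 0 →
    (proj (m + 1)).app U (f * x - aug U f • x) = 0
  /-- on `𝓙_m / 𝓙_{m+1}` the right action of `𝓕` is pulled back along `ε` -/
  right_action : ∀ (m : ℕ) (U : X.Opens) (f x : sheaf.Sec U), (proj m).app U x = 0 →
    (proj (m + 1)).app U (x * f - aug U f • x) = 0
  /-- over affine open sets the filtration defines the NC-topology of the ring of sections -/
  topology : ∀ U : X.Opens, IsAffineOpen U → ∀ s : ℕ, ∃ m : ℕ,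
    TwoSidedIdeal.ker ((proj m).app U) ≤ ncFil (sheaf.Sec U) s

namespace NCDeformation

variable {X : Scheme.{u}}

/-- The two-sided ideal `𝓙_m(U)` of `𝓕(U)`. -/
def ideal (D : NCDeformation X) (U : X.Opens) (m : ℕ) : TwoSidedIdeal (D.sheaf.Sec U) :=
  TwoSidedIdeal.ker ((D.proj m).app U)

/-- The deformation is NC-nilpotent: its filtration is finite, `𝓙_N = 0` for some `N`. -/
def IsNilpotent (D : NCDeformation X) : Prop := ∃ N : ℕ, ∀ U : X.Opens, D.ideal U N = ⊥

variable {A : CommRingCat.{u}}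

/-- The ring `Γ(Spec A, 𝓕)`. -/
abbrev Global (D : NCDeformation (Spec A)) : Type u := D.sheaf.Sec ⊤

/-- The homomorphism `Γ(Spec A, 𝓕) → Γ(Spec A, 𝒪) = A`. -/
def globalAug (D : NCDeformation (Spec A)) : D.Global →+* A :=
  (Scheme.ΓSpecIso A).hom.hom.comp (D.aug ⊤)

/-- The basic open subset `D(a)` of `Spec A`. -/
abbrev specBasic (a : A) : (Spec A).Opens := PrimeSpectrum.basicOpen a

/-- The restriction `Γ(Spec A, 𝓕) → Γ(D(a), 𝓕)`. -/
def toBasic (D : NCDeformation (Spec A)) (a : A) :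
    D.Global →+* D.sheaf.Sec (specBasic a) :=
  D.sheaf.res (homOfLE le_top)

/-- The restriction `Γ(Spec A, 𝓕) → Γ(D(a), 𝓕)` as a homomorphism of `A`-modules. -/
def toBasicLinear (D : NCDeformation (Spec A)) (a : A) :
    D.Global →ₗ[A] D.sheaf.Sec (specBasic a) where
  toFun := D.toBasic a
  map_add' := map_add (D.toBasic a)
  map_smul' := fun c x =>
    Scheme.Modules.map_smul_Spec (M := D.sheaf.toModules)
      (homOfLE (le_top : specBasic a ≤ ⊤)).op c x

/-- `𝓙_m(U)` as an `A`-submodule of `𝓕(U)`. -/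
def submodule (D : NCDeformation (Spec A)) (U : (Spec A).Opens) (m : ℕ) :
    Submodule A (D.sheaf.Sec U) where
  carrier := {x | x ∈ D.ideal U m}
  add_mem' := fun hx hy => (D.ideal U m).add_mem hx hy
  zero_mem' := (D.ideal U m).zero_mem
  smul_mem' := fun c x hx => by
    have h := (D.proj m).app_smul U
      ((Spec A).presheaf.map U.leTop.op ((Scheme.ΓSpecIso A).inv c)) x
    have hx' : (D.proj m).app U x = 0 := TwoSidedIdeal.mem_ker _ |>.mp hx
    rw [hx', smul_zero] at h
    exact TwoSidedIdeal.mem_ker _ |>.mpr h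

theorem submodule_le_comap (D : NCDeformation (Spec A)) (a : A) (m : ℕ) :
    D.submodule ⊤ m ≤ (D.submodule (specBasic a) m).comap (D.toBasicLinear a) := by
  intro x hx
  have hx' : (D.proj m).app ⊤ x = 0 := TwoSidedIdeal.mem_ker _ |>.mp hx
  refine TwoSidedIdeal.mem_ker _ |>.mpr ?_
  have h := (D.proj m).app_res (homOfLE (le_top : specBasic a ≤ ⊤)) x
  rw [hx', map_zero] at h
  change (D.proj m).app (specBasic a) (D.sheaf.res (homOfLE le_top) x) = 0
  exact h

/-- The homomorphism `Γ(Spec A, 𝓕) / Γ(Spec A, 𝓙_m) → Γ(D(a), 𝓕) / Γ(D(a), 𝓙_m)` of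
`A`-modules induced by restriction. -/
def quotToBasic (D : NCDeformation (Spec A)) (a : A) (m : ℕ) :
    (D.Global ⧸ D.submodule ⊤ m) →ₗ[A]
      (D.sheaf.Sec (specBasic a) ⧸ D.submodule (specBasic a) m) :=
  Submodule.mapQ _ _ (D.toBasicLinear a) (D.submodule_le_comap a m)

end NCDeformation

end NCDef

end

noncomputable section

namespace NCDef

/-! ### The commutator filtration and complete filtered rings -/

section RingLemmas

attribute [local instance] LieRing.ofAssociativeRing

variable {R S : Type u} [Ring R] [Ring S]

/-! The sheaf 𝓕 is not assumed quasi-coherent, but each 𝓕_m is. So the transition maps are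
surjective on global sections and over every D(a), and lifting step by step to the inverse limit
makes 𝓕 → 𝓕_m surjective there too (`proj_surjective`). Hence R/J_m → 𝓕(D(a))/𝓙_m(D(a)) is an
A-module localization.

This becomes a ring localization because ζ and a = ε(ζ) act in the same way on each J_m/J_{m+1}:
induction on m trades powers of a for powers of ζ (`IsTopLocalizationAway.of_smul`). The element ζ
is invertible over D(a) because ε(ζ) is and elements of 𝓙_1 are topologically nilpotent, so that a
geometric series gives inverses (`isUnit_of_isUnit_aug`).

The delicate point is J_1 = I_1(R), since 𝓙_1 is only the sheaf associated to the commutator ideals.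
One shows J_1 ⊆ I_1 + J_{m+1} by induction on m (`ideal_le_ncIdeal_sup`). An element of J_{m+1} that
is locally in the commutator ideal lands, modulo J_{m+2}, in the commutator ideal of a ring of
fractions, so a power of ζ carries it into I_1 + J_{m+2} (`exists_pow_mul_mem_of_map_mem_ncIdeal`).
These local memberships glue by A-linearity. As some J_m lies in F_1 ⊆ I_1, the induction ends. The
nilpotent case is the same statement at a level N with 𝓙_N = 0. -/

theorem ncIdeal_one_le_iff {K : TwoSidedIdeal R} :
    ncIdeal R 1 ≤ K ↔ ∀ x y : R, x * y - y * x ∈ K := by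
  refine ⟨fun h x y => h (commutator_mem R x y), fun h => ?_⟩
  refine TwoSidedIdeal.span_le.mpr fun z hz => ?_
  rw [SetLike.mem_coe, ← LieSubmodule.mem_toSubmodule, LieModule.lowerCentralSeries_succ,
    LieSubmodule.lieIdeal_oper_eq_linear_span'] at hz
  induction hz using Submodule.span_induction with
  | mem z hz =>
    obtain ⟨x, -, y, -, rfl⟩ := hz
    exact h x y
  | zero => exact K.zero_mem
  | add x y _ _ hx hy => exact K.add_mem hx hy
  | smul n x _ hx =>
    exact zsmul_mem hx n

theorem ncIdeal_antitone (R : Type u) [Ring R] : Antitone (ncIdeal R) := fun _ _ h =>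
  TwoSidedIdeal.span_mono (LieModule.antitone_lowerCentralSeries ℤ R R h)

theorem map_mem_ncIdeal (f : R →+* S) {t : ℕ} {x : R} (hx : x ∈ ncIdeal R t) :
    f x ∈ ncIdeal S t := by
  have h : ncIdeal R t ≤ (ncIdeal S t).comap f := by
    refine TwoSidedIdeal.span_le.mpr fun z hz => ?_
    refine (TwoSidedIdeal.mem_comap f).mpr (TwoSidedIdeal.subset_span ?_)
    exact LieIdeal.map_lowerCentralSeries_le t (f := (f.toIntAlgHom : R →ₗ⁅ℤ⁆ S))
      (LieIdeal.mem_map hz)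
  exact (TwoSidedIdeal.mem_comap f).mp (h hx)

theorem map_mem_ncFil (f : R →+* S) {m : ℕ} {x : R} (hx : x ∈ ncFil R m) :
    f x ∈ ncFil S m := by
  have h : ncFil R m ≤ (ncFil S m).comap f := by
    refine TwoSidedIdeal.span_le.mpr ?_
    rintro _ ⟨l, hl, hl', rfl⟩
    refine (TwoSidedIdeal.mem_comap f).mpr (TwoSidedIdeal.subset_span
      ⟨l.map (Prod.map id f), ?_, ?_, ?_⟩)
    · simpa [List.map_map, Function.comp_def] using hl
    · intro p hp
      obtain ⟨q, hq, rfl⟩ := List.mem_map.mp hp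
      exact map_mem_ncIdeal f (hl' q hq)
    · simp [List.map_map, Function.comp_def, map_list_prod]
  exact (TwoSidedIdeal.mem_comap f).mp (h hx)

theorem ncFil_le_ker (f : R →+* S) {m : ℕ} (h : ncFil S m = ⊥) :
    ncFil R m ≤ TwoSidedIdeal.ker f := fun x hx => by
  have := map_mem_ncFil f hx
  rw [h] at this
  exact (TwoSidedIdeal.mem_ker f).mpr ((TwoSidedIdeal.mem_bot S).mp this)

theorem IsNCNilpotent.of_injective (h : IsNCNilpotent S) (f : R →+* S)
    (hf : Function.Injective f) : IsNCNilpotent R := by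
  obtain ⟨s, hs⟩ := h
  refine ⟨s, eq_bot_iff.mpr fun x hx => ?_⟩
  have := (TwoSidedIdeal.mem_ker f).mp (ncFil_le_ker f hs hx)
  exact (TwoSidedIdeal.mem_bot R).mpr ((map_eq_zero_iff f hf).mp this)

theorem IsNCNilpotent.quotient_ker (h : IsNCNilpotent S) (f : R →+* S) :
    IsNCNilpotent (TwoSidedIdeal.ker f).ringCon.Quotient :=
  h.of_injective (RingCon.lift _ f fun x y hxy => by
      have := (TwoSidedIdeal.rel_iff _ x y).mp hxy
      rw [TwoSidedIdeal.mem_ker, map_sub, sub_eq_zero] at this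
      exact this) (by
    rw [injective_iff_map_eq_zero]
    intro q hq
    obtain ⟨x, rfl⟩ := (TwoSidedIdeal.ker f).ringCon.mk'_surjective q
    rw [← map_zero (TwoSidedIdeal.ker f).ringCon.mk']
    refine (TwoSidedIdeal.ker f).ringCon.eq.mpr ?_
    rw [← TwoSidedIdeal.mem_iff, TwoSidedIdeal.mem_ker]
    exact hq)

/-- A product of positive total degree has a factor of positive degree; as I_{i+1} ⊆ I_i, that
factor may be counted with degree one less. -/
theorem ncFil_succ_le (R : Type u) [Ring R] (m : ℕ) : ncFil R (m + 1) ≤ ncFil R m := by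
  have key : ∀ l : List (ℕ × R), (∀ p ∈ l, p.2 ∈ ncIdeal R p.1) → ∀ m,
      (l.map Prod.fst).sum = m + 1 → ∃ l' : List (ℕ × R), (∀ p ∈ l', p.2 ∈ ncIdeal R p.1) ∧
        (l'.map Prod.fst).sum = m ∧ (l'.map Prod.snd).prod = (l.map Prod.snd).prod := by
    intro l
    induction l with
    | nil => intro _ m h; simp at h
    | cons p l ih =>
      intro hl m h
      obtain ⟨i, x⟩ := p
      rw [List.map_cons, List.sum_cons] at h
      rw [List.forall_mem_cons] at hl
      cases i with
      | zero =>
        obtain ⟨l', h1, h2, h3⟩ := ih hl.2 m (by simpa using h)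
        exact ⟨(0, x) :: l', List.forall_mem_cons.mpr ⟨hl.1, h1⟩, by simpa using h2, by simp [h3]⟩
      | succ i =>
        exact ⟨(i, x) :: l, List.forall_mem_cons.mpr
          ⟨ncIdeal_antitone R i.le_succ hl.1, hl.2⟩, by simp at h ⊢; omega, by simp⟩
  refine TwoSidedIdeal.span_mono ?_
  rintro _ ⟨l, hl, hl', rfl⟩
  obtain ⟨l', h1, h2, h3⟩ := key l hl' m hl
  exact ⟨l', h2, h1, h3.symm⟩

theorem ncFil_antitone (R : Type u) [Ring R] : Antitone (ncFil R) :=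
  antitone_nat_of_succ_le (ncFil_succ_le R)

theorem ncFil_one_le (R : Type u) [Ring R] : ncFil R 1 ≤ ncIdeal R 1 := by
  refine TwoSidedIdeal.span_le.mpr ?_
  rintro _ ⟨l, hl, hl', rfl⟩
  induction l with
  | nil => simp at hl
  | cons p l ih =>
    obtain ⟨i, x⟩ := p
    rw [List.map_cons, List.sum_cons] at hl
    rw [List.forall_mem_cons] at hl'
    rw [List.map_cons, List.prod_cons]
    cases i with
    | zero => exact TwoSidedIdeal.mul_mem_left _ _ _ (ih (by simpa using hl) hl'.2)
    | succ i =>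
      exact TwoSidedIdeal.mul_mem_right _ _ _ (ncIdeal_antitone R (by simp) hl'.1)

theorem IsCompleteFor.sub_mem {J : ℕ → TwoSidedIdeal R} (hJ : Antitone J) {s : ℕ → R}
    (hs : ∀ m, s (m + 1) - s m ∈ J m) {m n : ℕ} (h : m ≤ n) : s n - s m ∈ J m := by
  induction n, h using Nat.le_induction with
  | base => simp
  | succ n hn ih =>
    have := (J m).add_mem (hJ hn (hs n)) ih
    rwa [sub_add_sub_cancel] at this

/-- Completeness depends only on the topology which the filtration defines. -/
theorem IsCompleteFor.of_cofinal {J K : ℕ → TwoSidedIdeal R} (hJ : Antitone J) (hK : Antitone K)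
    (h : IsCompleteFor J) (hJK : ∀ s, ∃ m, J m ≤ K s) (hKJ : ∀ m, ∃ s, K s ≤ J m) :
    IsCompleteFor K where
  hausdorff x hx := h.hausdorff x fun m => by
    obtain ⟨s, hs⟩ := hKJ m
    exact hs (hx s)
  complete s hs := by
    choose g hg using hKJ
    -- The sum makes `N` monotone and at least both `g` and the identity, so the subsequence `s ∘ N`
    -- is Cauchy for `J` at the required rate.
    let N : ℕ → ℕ := fun m => ∑ i ∈ Finset.range (m + 1), (g i + 1)
    have hN : ∀ m, N m ≤ N (m + 1) := fun m => by
      simp only [N]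
      rw [Finset.sum_range_succ _ (m + 1)]
      exact Nat.le_add_right _ _
    have hgN : ∀ m, g m ≤ N m := fun m => by
      simp only [N]
      rw [Finset.sum_range_succ _ m]
      omega
    have hmN : ∀ m, m ≤ N m := fun m => by
      have : ∑ i ∈ Finset.range (m + 1), 1 ≤ N m :=
        Finset.sum_le_sum fun i _ => Nat.le_add_left _ _
      simp at this
      omega
    obtain ⟨x, hx⟩ := h.complete (fun m => s (N m)) fun m =>
      hg m (hK (hgN m) (IsCompleteFor.sub_mem hK hs (hN m)))
    refine ⟨x, fun m => ?_⟩
    obtain ⟨k, hk⟩ := hJK m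
    have := (K m).add_mem (hk (hJ (le_max_left k m) (hx (max k m))))
      (IsCompleteFor.sub_mem hK hs ((le_max_right k m).trans (hmN (max k m))))
    rwa [sub_add_sub_cancel] at this

/-- The limit of the partial geometric sums is an inverse on both sides. -/
theorem IsCompleteFor.isUnit_one_sub {J : ℕ → TwoSidedIdeal R} (h : IsCompleteFor J) {j : R}
    (hj : ∀ m, j ^ m ∈ J m) : IsUnit (1 - j) := by
  obtain ⟨x, hx⟩ := h.complete (fun m => ∑ k ∈ Finset.range m, j ^ k) fun m => by
    simpa only [Finset.sum_range_succ, add_sub_cancel_left] using hj m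
  refine isUnit_iff_exists.mpr ⟨x, ?_, ?_⟩ <;> refine sub_eq_zero.mp (h.hausdorff _ fun m => ?_)
  · convert (J m).sub_mem ((J m).mul_mem_left (1 - j) _ (hx m)) (hj m) using 1
    rw [mul_sub, mul_neg_geom_sum]
    abel
  · convert (J m).sub_mem ((J m).mul_mem_right _ (1 - j) (hx m)) (hj m) using 1
    rw [sub_mul, geom_sum_mul_neg]
    abel

/-! ### Rings of fractions and topological localization -/

section Localization

variable {ζ : R} {ψ : R →+* S}

/-- The extension of a two-sided ideal `I` with commutative quotient to a ring of fractions: it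
consists of the elements `ζ⁻ⁿ y` with `y ∈ I`. -/
def extendedIdeal (I : TwoSidedIdeal R) (hI : ncIdeal R 1 ≤ I) (hu : IsUnit (ψ ζ))
    (hsurj : ∀ t : S, ∃ (n : ℕ) (r : R), ψ ζ ^ n * t = ψ r)
    (hker : ∀ r : R, ψ r = 0 → ∃ n : ℕ, ζ ^ n * r ∈ I) : TwoSidedIdeal S :=
  .mk' {t | ∃ n : ℕ, ∃ y ∈ I, ψ ζ ^ n * t = ψ y}
    ⟨0, 0, I.zero_mem, by simp⟩
    (by
      rintro s t ⟨n, y, hy, h⟩ ⟨k, z, hz, h'⟩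
      refine ⟨n + k, ζ ^ k * y + ζ ^ n * z, I.add_mem (I.mul_mem_left _ _ hy)
        (I.mul_mem_left _ _ hz), ?_⟩
      rw [map_add, map_mul, map_mul, ← h, ← h', map_pow, map_pow, mul_add, ← mul_assoc,
        ← mul_assoc, ← pow_add, ← pow_add, add_comm k n])
    (by
      rintro t ⟨n, y, hy, h⟩
      exact ⟨n, -y, I.neg_mem hy, by rw [mul_neg, h, map_neg]⟩)
    (by
      rintro s t ⟨n, y, hy, h⟩
      obtain ⟨v, hv⟩ := (hu.pow n).exists_left_inv
      obtain ⟨l, r, hr⟩ := hsurj (s * v)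
      refine ⟨l, r * y, I.mul_mem_left _ _ hy, ?_⟩
      rw [map_mul, ← hr, ← h, ← mul_assoc, ← mul_assoc, ← mul_assoc, mul_assoc _ v, hv, mul_one])
    (by
      rintro t s ⟨n, y, hy, h⟩
      obtain ⟨k, r, hr⟩ := hsurj s
      obtain ⟨v, hv⟩ := (hu.pow k).exists_left_inv
      obtain ⟨l, r', hr'⟩ := hsurj (ψ y * v)
      -- Moving ζ⁻ᵏ to the left of y: y ζ⁻ᵏ = ζ⁻ˡ r' in `S`, hence ζ^q r' ζ^k lies in I. Commutators
      -- lie in I, so ζ^k may be moved to the left of r'.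
      obtain ⟨q, hq⟩ := hker (ζ ^ l * y - r' * ζ ^ k) (by
        rw [map_sub, map_mul, map_mul, ← hr', map_pow, map_pow, mul_assoc, mul_assoc, hv, mul_one,
          sub_self])
      have h1 : ζ ^ (q + k) * r' ∈ I := by
        have h2 := I.mul_mem_left (ζ ^ q) _ (hI (commutator_mem R (ζ ^ k) r'))
        have h3 := I.sub_mem (I.mul_mem_left (ζ ^ q) _ (I.mul_mem_left (ζ ^ l) _ hy)) hq
        convert I.add_mem h2 h3 using 1
        rw [pow_add]
        noncomm_ring
      refine ⟨q + k + l + n, ζ ^ (q + k) * r' * r, I.mul_mem_right _ _ h1, ?_⟩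
      rw [map_mul, map_mul, ← hr, ← hr', map_pow]
      have h2 : ψ ζ ^ (q + k + l + n) * (t * s) = ψ ζ ^ (q + k) * (ψ ζ ^ l * ((ψ ζ ^ n * t) * s)) := by
        simp only [pow_add, mul_assoc]
      rw [h2, h]
      simp only [mul_assoc]
      rw [← mul_assoc v, hv, one_mul])

theorem mem_extendedIdeal {I : TwoSidedIdeal R} {hI : ncIdeal R 1 ≤ I} {hu : IsUnit (ψ ζ)}
    {hsurj : ∀ t : S, ∃ (n : ℕ) (r : R), ψ ζ ^ n * t = ψ r}
    {hker : ∀ r : R, ψ r = 0 → ∃ n : ℕ, ζ ^ n * r ∈ I} {t : S} :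
    t ∈ extendedIdeal I hI hu hsurj hker ↔ ∃ n : ℕ, ∃ y ∈ I, ψ ζ ^ n * t = ψ y :=
  TwoSidedIdeal.mem_mk' ..

/-- Modulo the extended ideal the images of elements of `R` commute with each other. Every element
is a fraction ζ⁻ⁿ r, so ζ becomes central and the quotient is commutative. -/
theorem ncIdeal_one_le_extendedIdeal (I : TwoSidedIdeal R) (hI : ncIdeal R 1 ≤ I)
    (hu : IsUnit (ψ ζ)) (hsurj : ∀ t : S, ∃ (n : ℕ) (r : R), ψ ζ ^ n * t = ψ r)
    (hker : ∀ r : R, ψ r = 0 → ∃ n : ℕ, ζ ^ n * r ∈ I) :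
    ncIdeal S 1 ≤ extendedIdeal I hI hu hsurj hker := by
  set L := extendedIdeal I hI hu hsurj hker
  let q := L.ringCon.mk'
  have hq : ∀ z, q z = 0 ↔ z ∈ L := fun z => by
    rw [TwoSidedIdeal.mem_iff, ← map_zero q]
    exact L.ringCon.eq
  have hcomm : ∀ r r' : R, Commute (q (ψ r)) (q (ψ r')) := fun r r' => by
    rw [commute_iff_eq, ← sub_eq_zero, ← map_mul, ← map_mul, ← map_mul, ← map_mul, ← map_sub,
      ← map_sub, hq]
    exact mem_extendedIdeal.mpr ⟨0, _, hI (commutator_mem R r r'), by simp⟩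
  have hqu : IsUnit (q (ψ ζ)) := hu.map q
  have hqs : ∀ {n : ℕ} {s : S} {r : R}, ψ ζ ^ n * s = ψ r → q (ψ ζ) ^ n * q s = q (ψ r) :=
    fun h => by rw [← h, map_mul, map_pow]
  have hu' : ∀ t, Commute (q (ψ ζ)) (q t) := fun t => by
    obtain ⟨n, r, h⟩ := hsurj t
    refine (hqu.pow n).mul_left_cancel ?_
    rw [← mul_assoc, ← pow_succ, pow_succ', mul_assoc, hqs h, ← mul_assoc, hqs h]
    exact hcomm ζ r
  refine ncIdeal_one_le_iff.mpr fun s t => ?_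
  obtain ⟨n, r, h⟩ := hsurj s
  obtain ⟨k, r', h'⟩ := hsurj t
  rw [← hq, map_sub, sub_eq_zero, map_mul, map_mul]
  refine (hqu.pow (n + k)).mul_left_cancel ?_
  have h1 : q (ψ ζ) ^ (n + k) * (q s * q t) = (q (ψ ζ) ^ n * q s) * (q (ψ ζ) ^ k * q t) := by
    rw [pow_add, mul_assoc, mul_assoc, ← mul_assoc _ (q s), ((hu' s).pow_left k).eq, mul_assoc]
  have h2 : q (ψ ζ) ^ (n + k) * (q t * q s) = (q (ψ ζ) ^ k * q t) * (q (ψ ζ) ^ n * q s) := by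
    rw [add_comm, pow_add, mul_assoc, mul_assoc, ← mul_assoc _ (q t), ((hu' t).pow_left n).eq,
      mul_assoc]
  rw [h1, h2, hqs h, hqs h']
  exact hcomm r r'

/-- The kernel of ψ is controlled only up to I. Thus ψ may be a localization of a quotient of `R` by
a smaller ideal, and that quotient need not be formed. -/
theorem exists_pow_mul_mem_of_map_mem_ncIdeal (I : TwoSidedIdeal R) (hI : ncIdeal R 1 ≤ I)
    (hu : IsUnit (ψ ζ)) (hsurj : ∀ t : S, ∃ (n : ℕ) (r : R), ψ ζ ^ n * t = ψ r)
    (hker : ∀ r : R, ψ r = 0 → ∃ n : ℕ, ζ ^ n * r ∈ I) {x : R} (hx : ψ x ∈ ncIdeal S 1) :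
    ∃ n : ℕ, ζ ^ n * x ∈ I := by
  obtain ⟨n, y, hy, h⟩ := mem_extendedIdeal.mp (ncIdeal_one_le_extendedIdeal I hI hu hsurj hker hx)
  obtain ⟨k, hk⟩ := hker (ζ ^ n * x - y) (by rw [map_sub, map_mul, map_pow, h, sub_self])
  refine ⟨k + n, ?_⟩
  convert I.add_mem hk (I.mul_mem_left (ζ ^ k) _ hy) using 1
  rw [pow_add]
  noncomm_ring

theorem IsTopLocalizationAway.isOreLocalizationAway {J : ℕ → TwoSidedIdeal R}
    {K : ℕ → TwoSidedIdeal S} (h : IsTopLocalizationAway J K ζ ψ) {N : ℕ} (hJ : J N = ⊥)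
    (hK : K N = ⊥) : IsOreLocalizationAway ζ ψ where
  isUnit := h.isUnit
  surj t := by
    obtain ⟨n, r, hr⟩ := h.surj N t
    rw [hK, TwoSidedIdeal.mem_bot, sub_eq_zero] at hr
    exact ⟨n, r, hr⟩
  ker r := by simpa only [hJ, hK, TwoSidedIdeal.mem_bot] using h.ker N r

/-- A filtered ring whose graded pieces are localized by the central action of a commutative ring
is a topological localization. -/
theorem IsTopLocalizationAway.of_smul {A : Type u} [CommRing A] [Module A R] [Module A S]
    {J : ℕ → TwoSidedIdeal R} {K : ℕ → TwoSidedIdeal S} (hK : Antitone K) (hJ0 : J 0 = ⊤)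
    (hK0 : K 0 = ⊤) (hcomplete : IsCompleteFor K) (hu : IsUnit (ψ ζ)) (a : A)
    (hJ : ∀ (n m : ℕ) (x : R), x ∈ J m → ζ ^ n * x - a ^ n • x ∈ J (m + 1))
    (hK' : ∀ (n m : ℕ) (x : S), x ∈ K m → ψ ζ ^ n * x - a ^ n • x ∈ K (m + 1))
    (hsurj : ∀ (m : ℕ) (t : S), ∃ (n : ℕ) (r : R), a ^ n • t - ψ r ∈ K m)
    (hker : ∀ (m : ℕ) (r : R), ψ r ∈ K m ↔ ∃ n : ℕ, a ^ n • r ∈ J m)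
    (hKsmul : ∀ (n m : ℕ) (x : S), x ∈ K m → a ^ n • x ∈ K m) :
    IsTopLocalizationAway J K ζ ψ where
  antitone := hK
  complete := hcomplete
  isUnit := hu
  surj m t := by
    induction m with
    | zero => exact ⟨0, 0, by rw [hK0]; trivial⟩
    | succ m ih =>
      obtain ⟨n, r, h⟩ := ih
      -- The error term lies in `K m`, where ζ^p and a^p agree modulo `K (m + 1)`; clearing its
      -- denominator by a^p is therefore as good as by ζ^p.
      obtain ⟨p, r', h'⟩ := hsurj (m + 1) (ψ ζ ^ n * t - ψ r)
      have hr' : ψ r' ∈ K m := by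
        have := (K m).sub_mem (hKsmul p m _ h) (hK m.le_succ h')
        rwa [sub_sub_cancel] at this
      refine ⟨p + n, ζ ^ p * r + r', ?_⟩
      convert (K (m + 1)).add_mem (hK' p m _ h) h' using 1
      rw [map_add, map_mul, map_pow, pow_add]
      noncomm_ring
  ker m r := by
    constructor
    · induction m with
      | zero => exact fun _ => ⟨0, by rw [hJ0]; trivial⟩
      | succ m ih =>
        intro h
        obtain ⟨n, hn⟩ := ih (hK m.le_succ h)
        -- Since ζ^n r is already in `J m`, a^p may be replaced by ζ^p modulo `J (m + 1)`.
        obtain ⟨p, hp⟩ := (hker (m + 1) (ζ ^ n * r)).mp (by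
          rw [map_mul]
          exact (K _).mul_mem_left _ _ h)
        refine ⟨p + n, ?_⟩
        have := (J (m + 1)).add_mem (hJ p m _ hn) hp
        rwa [sub_add_cancel, ← mul_assoc, ← pow_add] at this
    · rintro ⟨n, hn⟩
      have h1 : ψ (ζ ^ n * r) ∈ K m := (hker m _).mpr ⟨0, by simpa using hn⟩
      obtain ⟨v, hv⟩ := (hu.pow n).exists_left_inv
      have := (K m).mul_mem_left v _ h1
      rwa [map_mul, map_pow, ← mul_assoc, hv, one_mul] at this

end Localization

/-- The ideal of all c with c • x ∈ N is contained in no maximal ideal. -/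
theorem _root_.Submodule.mem_of_forall_exists_pow_smul_mem {A M : Type*} [CommRing A]
    [AddCommGroup M] [Module A M] (N : Submodule A M) (x : M)
    (h : ∀ p : PrimeSpectrum A, ∃ b, b ∉ p.asIdeal ∧ ∃ n : ℕ, b ^ n • x ∈ N) : x ∈ N := by
  let I : Ideal A := N.comap (LinearMap.toSpanSingleton A M x)
  by_cases hI : I = ⊤
  · have : (1 : A) ∈ I := hI ▸ Submodule.mem_top
    simpa [I] using this
  · obtain ⟨m, hm, hIm⟩ := Ideal.exists_le_maximal I hI
    obtain ⟨b, hb, n, hn⟩ := h ⟨m, hm.isPrime⟩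
    exact absurd (hm.isPrime.mem_of_pow_mem n (hIm (show b ^ n ∈ I by simpa [I] using hn))) hb

end RingLemmas
-- Quasi-coherent sheaves with a multiplication on Spec A
section SpecSections

variable {A : CommRingCat.{u}}

open NCDeformation (specBasic)

namespace RingedModule

variable (F : RingedModule (Spec A))

theorem spec_smul_def (U : (Spec A).Opens) (c : A) (x : F.Sec U) :
    c • x = ((Spec A).presheaf.map U.leTop.op ((Scheme.ΓSpecIso A).inv c) : Γ(Spec A, U)) • x :=
  rfl

/-- Restriction as a homomorphism of `A`-modules. -/
def resLinear {U V : (Spec A).Opens} (i : U ⟶ V) : F.Sec V →ₗ[A] F.Sec U where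
  toFun := F.res i
  map_add' := map_add (F.res i)
  map_smul' := fun c x => Scheme.Modules.map_smul_Spec (M := F.toModules) i.op c x

theorem res_smul {U V : (Spec A).Opens} (i : U ⟶ V) (c : A) (x : F.Sec V) :
    F.res i (c • x) = c • F.res i x := (F.resLinear i).map_smul c x

theorem res_res {X : Scheme.{u}} (F : RingedModule X) {U V W : X.Opens} (i : U ⟶ V) (j : V ⟶ W)
    (x : F.Sec W) : F.res i (F.res j x) = F.res (i ≫ j) x :=
  (congr($(F.toModules.presheaf.map_comp j.op i.op) x)).symm

theorem Hom.app_spec_smul {F G : RingedModule (Spec A)} (f : F.Hom G) (U : (Spec A).Opens) (c : A)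
    (x : F.Sec U) : f.app U (c • x) = c • f.app U x :=
  f.app_smul U _ x

theorem isLocalizedModule_resLinear (hF : F.toModules.IsQuasicoherent) (a : A) :
    IsLocalizedModule (Submonoid.powers a)
      (F.resLinear (homOfLE le_top : specBasic a ⟶ (⊤ : (Spec A).Opens))) :=
  (isIso_fromTildeΓ_iff_isLocalizing F.toModules).mp inferInstance a

/-- This needs no quasi-coherence, so it is available for 𝓕 itself and not only for the 𝓕_m. -/
theorem smul_pow_bijective (a : A) {U : (Spec A).Opens} (hU : U ≤ specBasic a) (n : ℕ) :
    Function.Bijective fun x : F.Sec U => a ^ n • x := by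
  have h := (Scheme.Modules.isUnit_algebraMap_end_of_le_basicOpen (M := F.toModules) a hU).pow n
  rw [← map_pow] at h
  exact (Module.End.isUnit_iff _).mp h

theorem exists_pow_smul_eq_res (hF : F.toModules.IsQuasicoherent) (a : A)
    (t : F.Sec (specBasic a)) : ∃ (n : ℕ) (r : F.Sec ⊤), a ^ n • t = F.res (homOfLE le_top) r := by
  have := F.isLocalizedModule_resLinear hF a
  obtain ⟨⟨r, ⟨_, n, rfl⟩⟩, h⟩ := IsLocalizedModule.surj (Submonoid.powers a)
    (F.resLinear (homOfLE le_top : specBasic a ⟶ (⊤ : (Spec A).Opens))) t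
  exact ⟨n, r, h⟩

theorem exists_pow_smul_eq_zero (hF : F.toModules.IsQuasicoherent) (a : A) {r : F.Sec ⊤}
    (h : F.res (homOfLE le_top : specBasic a ⟶ ⊤) r = 0) : ∃ n : ℕ, a ^ n • r = 0 := by
  have := F.isLocalizedModule_resLinear hF a
  obtain ⟨⟨_, n, rfl⟩, h⟩ := (IsLocalizedModule.eq_zero_iff (Submonoid.powers a)
    (F.resLinear (homOfLE le_top : specBasic a ⟶ (⊤ : (Spec A).Opens)))).mp h
  exact ⟨n, h⟩

end RingedModule

theorem exists_specBasic_le {V : (Spec A).Opens} {p : Spec A} (hp : p ∈ V) :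
    ∃ b : A, p ∈ specBasic b ∧ specBasic b ≤ V := by
  obtain ⟨_, ⟨_, ⟨b, rfl⟩, rfl⟩, hpb, hb⟩ :=
    PrimeSpectrum.isBasis_basic_opens.exists_subset_of_mem_open hp V.2
  exact ⟨b, hpb, hb⟩

/-- Global sections over an affine scheme preserve surjectivity of morphisms of quasi-coherent
sheaves, as long as the sections lift locally. -/
theorem RingedModule.Hom.surjective_top {F G : RingedModule (Spec A)} (f : F.Hom G)
    (hF : F.toModules.IsQuasicoherent) (hG : G.toModules.IsQuasicoherent) (hf : f.IsSurjective) :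
    Function.Surjective (f.app ⊤) := by
  intro x
  let N : Submodule A (G.Sec ⊤) :=
    { carrier := Set.range (f.app ⊤)
      add_mem' := by rintro _ _ ⟨y, rfl⟩ ⟨z, rfl⟩; exact ⟨y + z, map_add _ _ _⟩
      zero_mem' := ⟨0, map_zero _⟩
      smul_mem' := by rintro c _ ⟨y, rfl⟩; exact ⟨c • y, f.app_spec_smul _ _ _⟩ }
  refine N.mem_of_forall_exists_pow_smul_mem x fun p => ?_
  obtain ⟨V, i, t, hpV, ht⟩ := hf ⊤ x p trivial
  obtain ⟨b, hpb, hb⟩ := exists_specBasic_le hpV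
  refine ⟨b, hpb, ?_⟩
  -- After multiplication by b^n the local lift extends to a global y. Its image differs from b^n •
  -- x by a section vanishing on D(b), which a further power b^k kills.
  obtain ⟨n, y, hy⟩ := F.exists_pow_smul_eq_res hF b (F.res (homOfLE hb) t)
  have h1 : G.res (homOfLE le_top : specBasic b ⟶ ⊤) (f.app ⊤ y - b ^ n • x) = 0 := by
    rw [map_sub, ← f.app_res, ← hy, f.app_spec_smul, f.app_res, ht, G.res_res, G.res_smul]
    exact sub_self _
  obtain ⟨k, hk⟩ := G.exists_pow_smul_eq_zero hG b h1
  refine ⟨k + n, b ^ k • y, ?_⟩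
  rw [f.app_spec_smul, pow_add, mul_smul]
  rwa [smul_sub, sub_eq_zero] at hk

theorem RingedModule.Hom.surjective_specBasic {F G : RingedModule (Spec A)} (f : F.Hom G)
    (hG : G.toModules.IsQuasicoherent) (hf : Function.Surjective (f.app ⊤)) (a : A) :
    Function.Surjective (f.app (specBasic a)) := by
  intro t
  obtain ⟨n, x, hx⟩ := G.exists_pow_smul_eq_res hG a t
  obtain ⟨y, rfl⟩ := hf x
  obtain ⟨z, hz⟩ := (F.smul_pow_bijective a le_rfl n).surjective (F.res (homOfLE le_top) y)
  refine ⟨z, (G.smul_pow_bijective a le_rfl n).injective ?_⟩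
  rw [hx, ← f.app_spec_smul, ← f.app_res]
  exact congrArg _ hz

end SpecSections

namespace NCDeformation

/-! ### Completeness, units and lifting over a general open set -/

section Scheme

variable {X : Scheme.{u}} (D : NCDeformation X) (U : X.Opens)

theorem mem_ideal {m : ℕ} {x : D.sheaf.Sec U} : x ∈ D.ideal U m ↔ (D.proj m).app U x = 0 :=
  TwoSidedIdeal.mem_ker _

theorem ideal_antitone : Antitone (D.ideal U) := antitone_nat_of_succ_le fun m x hx => by
  rw [mem_ideal] at hx ⊢
  rw [← D.trans_proj, hx, map_zero]

theorem ideal_zero : D.ideal U 0 = ⊤ :=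
  top_le_iff.mp fun x _ => (D.mem_ideal U).mpr (D.quot_zero U x)

theorem res_mem_ideal {U V : X.Opens} (i : U ⟶ V) {m : ℕ} {x : D.sheaf.Sec V}
    (hx : x ∈ D.ideal V m) : D.sheaf.res i x ∈ D.ideal U m := by
  rw [mem_ideal] at hx ⊢
  rw [(D.proj m).app_res, hx, map_zero]

theorem isCompleteFor_ideal : IsCompleteFor (D.ideal U) where
  hausdorff x hx :=
    (D.limit U (fun _ => 0) fun _ => map_zero _).unique (fun m => (D.mem_ideal U).mp (hx m))
      fun _ => map_zero _
  complete s hs := by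
    obtain ⟨x, hx, -⟩ := D.limit U (fun m => (D.proj m).app U (s m)) fun m => by
      rw [D.trans_proj, ← sub_eq_zero, ← map_sub]
      exact (D.mem_ideal U).mp (hs m)
    exact ⟨x, fun m => (D.mem_ideal U).mpr (by rw [map_sub, hx, sub_self])⟩

theorem mem_ideal_one {x : D.sheaf.Sec U} : x ∈ D.ideal U 1 ↔ D.aug U x = 0 :=
  (D.mem_ideal U).trans (D.aug_ker U x).symm

/-- The map c ↦ c • 1 thus gives a section of ε over every open set. It need not be multiplicative,
but it supplies lifts of functions without any cohomological argument. -/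
theorem aug_smul_one (c : Γ(X, U)) : D.aug U (c • 1) = c := by
  rw [D.aug_smul, map_one, mul_one]

theorem isUnit_one_sub {j : D.sheaf.Sec U} (hj : j ∈ D.ideal U 1) : IsUnit (1 - j) :=
  (D.isCompleteFor_ideal U).isUnit_one_sub fun m => by
    induction m with
    | zero => rw [ideal_zero]; trivial
    | succ m ih =>
      -- As ε(j) = 0, left multiplication by j carries 𝓙_m into 𝓙_{m+1}.
      have := D.left_action m U j _ ((D.mem_ideal U).mp ih)
      rw [(D.mem_ideal_one U).mp hj, zero_smul, sub_zero, ← pow_succ'] at this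
      exact (D.mem_ideal U).mpr this

/-- With c the inverse of ε(f), both f (c • 1) and (c • 1) f are congruent to 1 modulo 𝓙_1, hence
units; this gives a right and a left inverse of f. -/
theorem isUnit_of_isUnit_aug {f : D.sheaf.Sec U} (hf : IsUnit (D.aug U f)) : IsUnit f := by
  obtain ⟨c, hc⟩ := hf.exists_right_inv
  have h1 : IsUnit (f * c • 1) := by
    have := D.isUnit_one_sub U (j := 1 - f * c • 1) ((D.mem_ideal_one U).mpr (by
      rw [map_sub, map_one, map_mul, aug_smul_one, hc, sub_self]))
    rwa [sub_sub_cancel] at this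
  have h2 : IsUnit (c • 1 * f) := by
    have := D.isUnit_one_sub U (j := 1 - c • 1 * f) ((D.mem_ideal_one U).mpr (by
      rw [map_sub, map_one, map_mul, aug_smul_one, mul_comm, hc, sub_self]))
    rwa [sub_sub_cancel] at this
  obtain ⟨v, hv⟩ := h1.exists_right_inv
  obtain ⟨w, hw⟩ := h2.exists_left_inv
  exact isUnit_iff_exists_and_exists.mpr ⟨⟨_, (mul_assoc _ _ _).symm.trans hv⟩,
    ⟨_, (mul_assoc _ _ _).trans hw⟩⟩

theorem trans_isSurjective (m : ℕ) : (D.trans m).IsSurjective := fun U s p hp => by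
  obtain ⟨V, i, t, hpV, ht⟩ := D.proj_surj m U s p hp
  exact ⟨V, i, _, hpV, (D.trans_proj m V t).trans ht⟩

theorem proj_surjective (h : ∀ m, Function.Surjective ((D.trans m).app U)) (m : ℕ) :
    Function.Surjective ((D.proj m).app U) := by
  have key : ∀ n : (D.quot m).Sec U, ∃ s : ∀ k, (D.quot k).Sec U,
      s m = n ∧ ∀ k < m, (D.trans k).app U (s (k + 1)) = s k := by
    induction m with
    | zero => exact fun n => ⟨Function.update 0 0 n, by simp, by simp⟩
    | succ m ih =>
      intro n
      obtain ⟨s, hs, hs'⟩ := ih ((D.trans m).app U n)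
      refine ⟨Function.update s (m + 1) n, by simp, fun k hk => ?_⟩
      rw [Function.update_of_ne hk.ne]
      rcases Nat.lt_succ_iff_lt_or_eq.mp hk with hk' | rfl
      · rw [Function.update_of_ne (by omega)]
        exact hs' k hk'
      · rw [Function.update_self, hs]
  intro n
  obtain ⟨s, hs, hs'⟩ := key n
  -- Up to level `m` the sequence consists of the images of `n`; above it each term is a chosen lift
  -- of the preceding one. The values of `s` beyond `m` carry no information.
  let g : ∀ k, (D.quot k).Sec U := Nat.rec (s 0) fun k x =>
    if k + 1 ≤ m then s (k + 1) else Function.surjInv (h k) x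
  have hg : ∀ k ≤ m, g k = s k := fun k hk => by
    cases k with
    | zero => rfl
    | succ k => exact if_pos hk
  obtain ⟨x, hx, -⟩ := D.limit U g fun k => by
    by_cases hk : k + 1 ≤ m
    · rw [hg _ hk, hg _ (by omega), hs' k hk]
    · have : g (k + 1) = Function.surjInv (h k) (g k) := if_neg hk
      rw [this]
      exact Function.surjInv_eq (h k) (g k)
  exact ⟨x, by rw [hx, hg m le_rfl, hs]⟩

end Scheme

end NCDeformation
namespace NCDeformation

/-! ### Global sections of a deformation of Spec A -/

section Affine

variable {A : CommRingCat.{u}} (D : NCDeformation (Spec A))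

theorem trans_surjective_top (m : ℕ) : Function.Surjective ((D.trans m).app ⊤) :=
  (D.trans m).surjective_top (D.quasicoherent _) (D.quasicoherent _) (D.trans_isSurjective m)

theorem proj_surjective_top (m : ℕ) : Function.Surjective ((D.proj m).app ⊤) :=
  D.proj_surjective ⊤ D.trans_surjective_top m

theorem proj_surjective_specBasic (a : A) (m : ℕ) :
    Function.Surjective ((D.proj m).app (specBasic a)) :=
  D.proj_surjective _ (fun m => (D.trans m).surjective_specBasic (D.quasicoherent _)
    (D.trans_surjective_top m) a) m

theorem smul_mem_ideal (U : (Spec A).Opens) {m : ℕ} (c : A) {x : D.sheaf.Sec U}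
    (hx : x ∈ D.ideal U m) : c • x ∈ D.ideal U m :=
  (D.submodule U m).smul_mem c hx

/-- Denominators are cleared in the quasi-coherent 𝓕_m, and the resulting global section is lifted
to 𝓕; this is why equality holds only modulo 𝓙_m. -/
theorem exists_pow_smul_sub_toBasic_mem (a : A) (m : ℕ) (t : D.sheaf.Sec (specBasic a)) :
    ∃ (n : ℕ) (r : D.Global), a ^ n • t - D.toBasic a r ∈ D.ideal (specBasic a) m := by
  obtain ⟨n, y, hy⟩ := (D.quot m).exists_pow_smul_eq_res (D.quasicoherent m) a ((D.proj m).app _ t)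
  obtain ⟨r, rfl⟩ := D.proj_surjective_top m y
  refine ⟨n, r, (D.mem_ideal _).mpr ?_⟩
  rw [map_sub, (D.proj m).app_spec_smul, hy, sub_eq_zero]
  exact ((D.proj m).app_res _ r).symm

theorem toBasic_mem_ideal_iff (a : A) (m : ℕ) (r : D.Global) :
    D.toBasic a r ∈ D.ideal (specBasic a) m ↔ ∃ n : ℕ, a ^ n • r ∈ D.ideal ⊤ m := by
  constructor
  · intro h
    obtain ⟨n, hn⟩ := (D.quot m).exists_pow_smul_eq_zero (D.quasicoherent m) a
      (r := (D.proj m).app ⊤ r) (by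
        rw [← (D.proj m).app_res]
        exact (D.mem_ideal _).mp h)
    exact ⟨n, (D.mem_ideal _).mpr (((D.proj m).app_spec_smul _ _ _).trans hn)⟩
  · rintro ⟨n, hn⟩
    have h := D.res_mem_ideal (homOfLE le_top : specBasic a ⟶ ⊤) hn
    rw [D.sheaf.res_smul, mem_ideal, (D.proj m).app_spec_smul] at h
    refine (D.mem_ideal _).mpr (((D.quot m).smul_pow_bijective a le_rfl n).injective ?_)
    exact h.trans (smul_zero _).symm

theorem aug_res_top (U : (Spec A).Opens) (f : D.Global) :
    D.aug U (D.sheaf.res (homOfLE le_top) f) =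
      (Spec A).presheaf.map U.leTop.op ((Scheme.ΓSpecIso A).inv (D.globalAug f)) := by
  rw [D.aug_res]
  congr 1
  exact (congr($((Scheme.ΓSpecIso A).hom_inv_id) (D.aug ⊤ f))).symm

theorem globalAug_smul (U : (Spec A).Opens) (f : D.Global) (x : D.sheaf.Sec U) :
    D.globalAug f • x = D.aug U (D.sheaf.res (homOfLE le_top) f) • x := by
  rw [D.sheaf.spec_smul_def, aug_res_top]

theorem res_mul_sub_mem (U : (Spec A).Opens) {m : ℕ} (f : D.Global) {x : D.sheaf.Sec U}
    (hx : x ∈ D.ideal U m) :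
    D.sheaf.res (homOfLE le_top) f * x - D.globalAug f • x ∈ D.ideal U (m + 1) := by
  rw [globalAug_smul]
  exact (D.mem_ideal U).mpr (D.left_action m U _ x ((D.mem_ideal U).mp hx))

theorem mul_res_sub_mem (U : (Spec A).Opens) {m : ℕ} (f : D.Global) {x : D.sheaf.Sec U}
    (hx : x ∈ D.ideal U m) :
    x * D.sheaf.res (homOfLE le_top) f - D.globalAug f • x ∈ D.ideal U (m + 1) := by
  rw [globalAug_smul]
  exact (D.mem_ideal U).mpr (D.right_action m U _ x ((D.mem_ideal U).mp hx))

theorem res_top (f : D.Global) : D.sheaf.res (homOfLE le_top : (⊤ : (Spec A).Opens) ⟶ ⊤) f = f :=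
  congr($(D.sheaf.toModules.presheaf.map_id (op ⊤)) f)

theorem mul_sub_mem {m : ℕ} (f : D.Global) {x : D.Global} (hx : x ∈ D.ideal ⊤ m) :
    f * x - D.globalAug f • x ∈ D.ideal ⊤ (m + 1) := by
  simpa only [res_top] using D.res_mul_sub_mem ⊤ f hx

theorem mul_sub_mem' {m : ℕ} (f : D.Global) {x : D.Global} (hx : x ∈ D.ideal ⊤ m) :
    x * f - D.globalAug f • x ∈ D.ideal ⊤ (m + 1) := by
  simpa only [res_top] using D.mul_res_sub_mem ⊤ f hx

theorem globalAug_smul_one (c : A) : D.globalAug (c • 1) = c := by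
  have h := D.aug_smul_one ⊤ ((Spec A).presheaf.map (⊤ : (Spec A).Opens).leTop.op
    ((Scheme.ΓSpecIso A).inv c))
  refine (congrArg (Scheme.ΓSpecIso A).hom h).trans ?_
  have h1 : (Spec A).presheaf.map (⊤ : (Spec A).Opens).leTop.op ((Scheme.ΓSpecIso A).inv c) =
      (Scheme.ΓSpecIso A).inv c := congr($((Spec A).presheaf.map_id (op ⊤)) _)
  rw [h1]
  exact congr($((Scheme.ΓSpecIso A).inv_hom_id) c)

theorem globalAug_eq_zero_iff (x : D.Global) : D.globalAug x = 0 ↔ x ∈ D.ideal ⊤ 1 := by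
  rw [mem_ideal_one]
  exact map_eq_zero_iff _ (Scheme.ΓSpecIso A).commRingCatIsoToRingEquiv.injective

theorem isUnit_toBasic (ζ : D.Global) : IsUnit (D.toBasic (D.globalAug ζ) ζ) := by
  refine D.isUnit_of_isUnit_aug _ ?_
  have h := D.aug_res_top (specBasic (D.globalAug ζ)) ζ
  refine (congrArg IsUnit h).mpr ?_
  exact IsLocalization.Away.algebraMap_isUnit (R := A) (S := Γ(Spec A, specBasic (D.globalAug ζ)))
    (D.globalAug ζ)

theorem isTopLocalizationAway (ζ : D.Global) :
    IsTopLocalizationAway (D.ideal ⊤) (D.ideal (specBasic (D.globalAug ζ))) ζ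
      (D.toBasic (D.globalAug ζ)) :=
  .of_smul (D.ideal_antitone _) (D.ideal_zero _) (D.ideal_zero _) (D.isCompleteFor_ideal _)
    (D.isUnit_toBasic ζ) (D.globalAug ζ)
    (fun n m x hx => by
      rw [← map_pow]
      exact D.mul_sub_mem _ hx)
    (fun n m x hx => by
      rw [← map_pow, ← map_pow]
      exact D.res_mul_sub_mem _ _ hx)
    (D.exists_pow_smul_sub_toBasic_mem _) (D.toBasic_mem_ideal_iff _)
    fun n m x hx => D.smul_mem_ideal _ _ hx

theorem ncIdeal_one_le_ideal : ncIdeal D.Global 1 ≤ D.ideal ⊤ 1 :=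
  ncIdeal_one_le_iff.mpr fun x y => by
    rw [← globalAug_eq_zero_iff, map_sub, map_mul, map_mul, mul_comm, sub_self]

/-- Working modulo J_{m+2} brings in genuine rings of fractions, while on J_{m+1} modulo J_{m+2} the
ring acts through A, which allows gluing over Spec A. -/
theorem ideal_le_ncIdeal_sup (m : ℕ) :
    D.ideal ⊤ 1 ≤ ncIdeal D.Global 1 ⊔ D.ideal ⊤ (m + 1) := by
  induction m with
  | zero => exact le_sup_right
  | succ m ih =>
    set I := ncIdeal D.Global 1 ⊔ D.ideal ⊤ (m + 2)
    have hI : ncIdeal D.Global 1 ≤ I := le_sup_left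
    have hJ : D.ideal ⊤ (m + 2) ≤ I := le_sup_right
    -- The ideal `I` need not be stable under A. Its intersection with J_{m+1} is, because there c •
    -- x and (c • 1) * x differ by an element of J_{m+2} ⊆ `I`.
    let N : Submodule A D.Global :=
      { carrier := {x | x ∈ D.ideal ⊤ (m + 1) ∧ x ∈ I}
        add_mem' := fun hx hy => ⟨(D.ideal ⊤ _).add_mem hx.1 hy.1, I.add_mem hx.2 hy.2⟩
        zero_mem' := ⟨(D.ideal ⊤ _).zero_mem, I.zero_mem⟩
        smul_mem' := fun c x hx => by
          refine ⟨D.smul_mem_ideal _ c hx.1, ?_⟩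
          have h := D.mul_sub_mem (c • 1) hx.1
          rw [globalAug_smul_one] at h
          have h' := I.sub_mem (I.mul_mem_left (c • 1) _ hx.2) (hJ h)
          rwa [sub_sub_cancel] at h' }
    intro x hx
    obtain ⟨y, hy, z, hz, rfl⟩ := TwoSidedIdeal.mem_sup.mp (ih hx)
    have hz1 : z ∈ D.ideal ⊤ 1 := D.ideal_antitone ⊤ (by omega) hz
    refine I.add_mem (hI hy) (N.mem_of_forall_exists_pow_smul_mem z fun p => ?_).2
    obtain ⟨V, i, hpV, hV⟩ := (D.commutator ⊤ z).mp ((D.mem_ideal ⊤).mp hz1) p trivial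
    obtain ⟨b, hpb, hb⟩ := exists_specBasic_le hpV
    refine ⟨b, hpb, ?_⟩
    obtain ⟨ζ, rfl⟩ : ∃ ζ, D.globalAug ζ = b := ⟨_, D.globalAug_smul_one b⟩
    have hloc := D.isTopLocalizationAway ζ
    -- The target is the ring of fractions of R/J_{m+2} at ζ, and J_{m+2} ⊆ `I` provides the kernel
    -- condition.
    let ψ : D.Global →+* (D.quot (m + 2)).Sec (specBasic (D.globalAug ζ)) :=
      ((D.proj (m + 2)).app _).comp (D.toBasic (D.globalAug ζ))
    have hψz : ψ z ∈ ncIdeal _ 1 := by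
      have h := map_mem_ncIdeal (D.sheaf.res (homOfLE hb)) hV
      rw [D.sheaf.res_res] at h
      exact map_mem_ncIdeal ((D.proj (m + 2)).app (specBasic (D.globalAug ζ))) h
    obtain ⟨n, hn⟩ := exists_pow_mul_mem_of_map_mem_ncIdeal (ψ := ψ) (ζ := ζ) (x := z) I hI
      (hloc.isUnit.map ((D.proj (m + 2)).app _)) (fun t => by
        obtain ⟨t, rfl⟩ := D.proj_surjective_specBasic _ _ t
        obtain ⟨n, r, h⟩ := hloc.surj (m + 2) t
        refine ⟨n, r, ?_⟩
        rw [mem_ideal, map_sub, sub_eq_zero, map_mul, map_pow] at h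
        exact h) (fun r hr => by
        obtain ⟨n, hn⟩ := (hloc.ker (m + 2) r).mp ((D.mem_ideal _).mpr hr)
        exact ⟨n, hJ hn⟩) hψz
    refine ⟨n, D.smul_mem_ideal _ _ hz, ?_⟩
    -- Back from ζ^n z to b^n • z, at the cost of an element of J_{m+2} ⊆ `I`.
    have h := D.mul_sub_mem (ζ ^ n) hz
    rw [map_pow] at h
    have h' := I.sub_mem hn (hJ h)
    rwa [sub_sub_cancel] at h'

theorem ideal_one : D.ideal ⊤ 1 = ncIdeal D.Global 1 := by
  refine le_antisymm ?_ D.ncIdeal_one_le_ideal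
  obtain ⟨m, hm⟩ := D.topology ⊤ (isAffineOpen_top _) 1
  refine (D.ideal_le_ncIdeal_sup m).trans (sup_le le_rfl ?_)
  exact (D.ideal_antitone ⊤ m.le_succ).trans (hm.trans (ncFil_one_le _))

theorem isNCFiltration : IsNCFiltration (D.ideal ⊤) where
  antitone := D.ideal_antitone ⊤
  zero := D.ideal_zero ⊤
  one := D.ideal_one
  quotient_nilpotent m := (D.quot_nilpotent m ⊤).quotient_ker _
  complete := D.isCompleteFor_ideal ⊤
  topology := D.topology ⊤ (isAffineOpen_top _)

/-- The filtrations J_m and F_s are cofinal: one direction is the topology axiom, the other the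
NC-nilpotence of the rings 𝓕_m(X). -/
theorem isNCComplete : IsNCComplete D.Global :=
  (D.isCompleteFor_ideal ⊤).of_cofinal (D.ideal_antitone ⊤) (ncFil_antitone _)
    (D.topology ⊤ (isAffineOpen_top _)) fun m => by
      obtain ⟨s, hs⟩ := D.quot_nilpotent m ⊤
      exact ⟨s, ncFil_le_ker _ hs⟩

theorem isNCDeformation : IsNCDeformation D.globalAug (D.ideal ⊤) where
  ncComplete := D.isNCComplete
  filtration := D.isNCFiltration
  surjective c := ⟨_, D.globalAug_smul_one c⟩
  ker x := by rw [globalAug_eq_zero_iff, ideal_one]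
  smul_mem _ c _ hx := D.smul_mem_ideal ⊤ c hx
  left_action _ r _ hx := D.mul_sub_mem r hx
  right_action _ r _ hx := D.mul_sub_mem' r hx

/-- The identification `R_c = A` for the ring `R` of global sections. -/
def commEquiv : Comm D.Global ≃+* A :=
  RingEquiv.ofBijective (RingCon.lift _ D.globalAug fun x y hxy => by
      change D.globalAug x = D.globalAug y
      rw [← sub_eq_zero, ← map_sub, globalAug_eq_zero_iff, ideal_one]
      exact (TwoSidedIdeal.rel_iff _ x y).mp hxy : Comm D.Global →+* A) (by
    refine ⟨(injective_iff_map_eq_zero _).mpr fun q hq => ?_, fun c => ?_⟩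
    · obtain ⟨x, rfl⟩ := toComm_surjective _ q
      rw [toComm_eq_zero_iff, ← ideal_one, ← globalAug_eq_zero_iff]
      exact hq
    · exact ⟨toComm _ (c • 1), D.globalAug_smul_one c⟩)

/-- The identification `Spec A = Spec R_c` for the ring `R` of global sections. -/
def specHomeo : (Spec A).toTopCat ≃ₜ PrimeSpectrum (Comm D.Global) :=
  PrimeSpectrum.homeomorphOfRingEquiv D.commEquiv.symm

theorem isNCSpf : IsNCSpf D.sheaf.ringSheaf (D.ideal ⊤) :=
  -- The preimage of D(ζ) under `specHomeo` unfolds to D(ε(ζ)), so the localization statement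
  -- applies without transport.
  ⟨D.specHomeo, RingHom.id _, D.ideal, fun _ _ i _ _ hx => D.res_mem_ideal i hx,
    D.isTopLocalizationAway⟩

theorem isLocalizedModule_quotToBasic (a : A) (m : ℕ) :
    IsLocalizedModule (Submonoid.powers a) (D.quotToBasic a m) where
  map_units := by
    rintro ⟨_, n, rfl⟩
    rw [Module.End.isUnit_iff]
    have hbij := D.sheaf.smul_pow_bijective a (U := specBasic a) le_rfl n
    -- Surjectivity of a^n on the quotient comes from 𝓕(D(a)), injectivity from 𝓕_m(D(a)), into
    -- which the quotient embeds.
    have hbij' := (D.quot m).smul_pow_bijective a (U := specBasic a) le_rfl n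
    constructor
    · rw [← LinearMap.ker_eq_bot, LinearMap.ker_eq_bot']
      intro q hq
      obtain ⟨x, rfl⟩ := Submodule.Quotient.mk_surjective _ q
      have hx : a ^ n • x ∈ D.ideal (specBasic a) m := (Submodule.Quotient.mk_eq_zero _).mp hq
      refine (Submodule.Quotient.mk_eq_zero _).mpr ((D.mem_ideal _).mpr (hbij'.injective ?_))
      rw [mem_ideal, (D.proj m).app_spec_smul] at hx
      exact hx.trans (smul_zero _).symm
    · intro q
      obtain ⟨x, rfl⟩ := Submodule.Quotient.mk_surjective _ q
      obtain ⟨y, rfl⟩ := hbij.surjective x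
      exact ⟨Submodule.Quotient.mk y, rfl⟩
  surj q := by
    obtain ⟨t, rfl⟩ := Submodule.Quotient.mk_surjective _ q
    obtain ⟨n, r, h⟩ := D.exists_pow_smul_sub_toBasic_mem a m t
    exact ⟨⟨Submodule.Quotient.mk r, ⟨_, n, rfl⟩⟩, (Submodule.Quotient.eq _).mpr h⟩
  exists_of_eq := by
    intro q q' h
    obtain ⟨x, rfl⟩ := Submodule.Quotient.mk_surjective _ q
    obtain ⟨y, rfl⟩ := Submodule.Quotient.mk_surjective _ q'
    have h' : D.toBasic a (x - y) ∈ D.ideal (specBasic a) m := by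
      rw [map_sub]
      exact (Submodule.Quotient.eq _).mp h
    obtain ⟨n, hn⟩ := (D.toBasic_mem_ideal_iff a m _).mp h'
    rw [smul_sub] at hn
    exact ⟨⟨_, n, rfl⟩, (Submodule.Quotient.eq _).mpr hn⟩

theorem isLocalizedModule_toBasicLinear {N : ℕ} (hN : ∀ U, D.ideal U N = ⊥) (a : A) :
    IsLocalizedModule (Submonoid.powers a) (D.toBasicLinear a) where
  map_units := by
    rintro ⟨_, n, rfl⟩
    rw [Module.End.isUnit_iff]
    exact D.sheaf.smul_pow_bijective a (U := specBasic a) le_rfl n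
  surj t := by
    obtain ⟨n, r, h⟩ := D.exists_pow_smul_sub_toBasic_mem a N t
    rw [hN, TwoSidedIdeal.mem_bot, sub_eq_zero] at h
    exact ⟨⟨r, ⟨_, n, rfl⟩⟩, h⟩
  exists_of_eq := by
    intro x y h
    have h' : D.toBasic a (x - y) ∈ D.ideal (specBasic a) N := by
      rw [hN, TwoSidedIdeal.mem_bot, map_sub, sub_eq_zero]
      exact h
    obtain ⟨n, hn⟩ := (D.toBasic_mem_ideal_iff a N _).mp h'
    rw [hN, TwoSidedIdeal.mem_bot, smul_sub, sub_eq_zero] at hn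
    exact ⟨⟨_, n, rfl⟩, hn⟩

theorem isNCNilpotent {N : ℕ} (hN : D.ideal ⊤ N = ⊥) : IsNCNilpotent D.Global := by
  obtain ⟨s, hs⟩ := D.quot_nilpotent N ⊤
  exact ⟨s, eq_bot_iff.mpr ((ncFil_le_ker _ hs).trans hN.le)⟩

theorem isOreLocalizationAway {N : ℕ} (hN : ∀ U, D.ideal U N = ⊥) (ζ : D.Global) :
    IsOreLocalizationAway ζ (D.toBasic (D.globalAug ζ)) :=
  (D.isTopLocalizationAway ζ).isOreLocalizationAway (hN _) (hN _)

theorem isNCSpec {N : ℕ} (hN : ∀ U, D.ideal U N = ⊥) : IsNCSpec D.sheaf.ringSheaf D.Global :=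
  ⟨D.specHomeo, RingHom.id _, D.isOreLocalizationAway hN⟩

end Affine

end NCDeformation
end NCDef

end

theorem mainTheorem3 {A : CommRingCat.{u}} (D : NCDef.NCDeformation (Spec A)) :
    NCDef.IsNCDeformation D.globalAug (D.ideal ⊤) ∧
    NCDef.IsAffineNCScheme D.sheaf.ringSheaf ∧
    NCDef.IsNCSpf D.sheaf.ringSheaf (D.ideal ⊤) ∧
    (∀ ζ : D.Global, NCDef.IsTopLocalizationAway (D.ideal ⊤)
      (D.ideal (NCDef.NCDeformation.specBasic (D.globalAug ζ))) ζ (D.toBasic (D.globalAug ζ))) ∧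
    (∀ (a : A) (m : ℕ), IsLocalizedModule (Submonoid.powers a) (D.quotToBasic a m)) ∧
    (D.IsNilpotent →
      NCDef.IsNCNilpotent D.Global ∧
      (∃ N : ℕ, D.ideal ⊤ N = ⊥) ∧
      NCDef.IsAffineNCNilpotentScheme D.sheaf.ringSheaf ∧
      NCDef.IsNCSpec D.sheaf.ringSheaf D.Global ∧
      (∀ ζ : D.Global, NCDef.IsOreLocalizationAway ζ (D.toBasic (D.globalAug ζ))) ∧
      (∀ a : A, IsLocalizedModule (Submonoid.powers a) (D.toBasicLinear a))) := by
  refine ⟨D.isNCDeformation, ⟨D.Global, inferInstance, D.ideal ⊤, D.isNCComplete,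
    D.isNCFiltration, D.isNCSpf⟩, D.isNCSpf, D.isTopLocalizationAway,
    D.isLocalizedModule_quotToBasic, ?_⟩
  rintro ⟨N, hN⟩
  exact ⟨D.isNCNilpotent (hN ⊤), ⟨N, hN ⊤⟩,
    ⟨D.Global, inferInstance, D.isNCNilpotent (hN ⊤), D.isNCSpec hN⟩, D.isNCSpec hN,
    D.isOreLocalizationAway hN, D.isLocalizedModule_toBasicLinear hN⟩
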